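/- Let $\zeta$ be the Riemann zeta function, $\Gamma$ the Gamma function and $\gamma$ the Euler--Mascheroni constant. The series $\sum_{j\ge 1}\frac{1}{e^{j}-1}$ converges and the two integrals below converge absolutely, and $$\frac{1}{2\pi}\int_{-\infty}^{\infty}\zeta\left(\tfrac12+iv\right)^{2}\,\Gamma\left(\tfrac12+iv\right)dv=\sum_{j=1}^{\infty}\frac{1}{e^{j}-1}-\gamma ,$$ $$\int_{0}^{\infty}\frac{\left|\zeta\left(\tfrac12+iv\right)\right|^{2}}{\cosh(\pi v)}\left(\cos\left(v\ln(2\pi)\right)\cosh\left(\frac{\pi v}{2}\right)-\sin\left(v\ln(2\pi)\right)\sinh\left(\frac{\pi v}{2}\right)\right)dv=\sqrt{\pi}\left(\sum_{j=1}^{\infty}\frac{1}{e^{j}-1}-\gamma\right).$$ -/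

import Mathlib

/-! Near `s = 1`, `ζ² Γ = 1/(s-1)² + γ/(s-1) + ⋯`, because `((s-1)² ζ² Γ)' (1) = 2γ + Γ'(1) = γ`.
Moving the line of integration from `re s = 1/2` to `re s = 2` therefore changes the integral by
`2πγ`. On `re s = 2` the double Dirichlet series of `ζ²` is integrated term by term; Mellin
inversion turns `(mn)⁻ˢ Γ(s)` into `2π e^{-mn}`, and `∑ₙ e^{-mn} = 1/(e^m - 1)`.

The analytic input is that `(s-1) ζ(s)` is `O(|s|²)` on `re s ≥ 1/2` (`exists_norm_riemannZeta₁_le`)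
and that `Γ(s)` is `O(|s|⁻⁴)` on `0 < re s ≤ 2` (`norm_Gamma_mul_norm_pow_four_le`). Hence `(s-1)²
ζ² Γ` is bounded on the strip `1/2 ≤ re s ≤ 2`. Crude bounds thus suffice, with no need for
Stirling's formula.

The second identity is the real part of the first: on the critical line the functional equation
rewrites `ζ² Γ` through `|ζ|²` (`zetaSqGamma_half_eq`), and the resulting integrand is even. -/

/-! ### Growth of `(s - 1) ζ(s)` for `re s ≥ 1/2` -/

open Complex in
theorem norm_ofReal_cpow_neg_sub_le {s : ℂ} (hs : 0 ≤ s.re) {a x : ℝ} (ha : 0 < a)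
    (hx : x ∈ Set.Icc a (a + 1)) :
    ‖(x : ℂ) ^ (-s) - (a : ℂ) ^ (-s)‖ ≤ ‖s‖ * a ^ (-s.re - 1) := by
  have hd : ∀ y ∈ Set.Icc a (a + 1), HasDerivWithinAt (fun y : ℝ ↦ (y : ℂ) ^ (-s))
      (-s * (y : ℂ) ^ (-s - 1)) (Set.Icc a (a + 1)) y := fun y hy ↦ by
    have hy0 : 0 < y := ha.trans_le hy.1
    have h := (hasDerivAt_id (y : ℂ)).cpow_const (c := -s) (Or.inl (by simpa using hy0))
    simpa using h.comp_ofReal.hasDerivWithinAt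
  have hb : ∀ y ∈ Set.Icc a (a + 1), ‖-s * (y : ℂ) ^ (-s - 1)‖ ≤ ‖s‖ * a ^ (-s.re - 1) := fun y hy ↦ by
    rw [norm_mul, norm_neg, norm_cpow_eq_rpow_re_of_pos (ha.trans_le hy.1)]
    simp only [sub_re, neg_re, one_re]
    exact mul_le_mul_of_nonneg_left (Real.rpow_le_rpow_of_nonpos ha hy.1 (by linarith)) (norm_nonneg _)
  have h := Convex.norm_image_sub_le_of_norm_hasDerivWithin_le hd hb (convex_Icc _ _)
    (Set.left_mem_Icc.2 (by linarith)) hx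
  refine h.trans (mul_le_of_le_one_right (by positivity) ?_)
  rw [Real.norm_eq_abs, abs_le]
  constructor <;> linarith [hx.1, hx.2]

/-- The summand of the series `(s - 1) ζ(s) = 1 + ∑ ((s - 1) n⁻ˢ - n¹⁻ˢ + (n + 1)¹⁻ˢ)`, shifted so
that it starts from `n = 0`. -/
noncomputable def zetaOneTerm (n : ℕ) (s : ℂ) : ℂ :=
  (s - 1) * ((n : ℂ) + 1) ^ (-s) - ((n : ℂ) + 1) ^ (1 - s) + ((n : ℂ) + 1 + 1) ^ (1 - s)

-- With `a = n + 1`, the term is the increment over `[a, a + 1]` of `y ↦ y^{1-s} + (s-1) a^{-s} y`.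
-- The linear part makes the derivative vanish at `a`, which gains the power of `a` needed for
-- convergence when `re s > 0`.
open Complex in
theorem norm_zetaOneTerm_le {s : ℂ} (hs : 0 ≤ s.re) (n : ℕ) :
    ‖zetaOneTerm n s‖ ≤ ‖s - 1‖ * ‖s‖ * ((n : ℝ) + 1) ^ (-s.re - 1) := by
  set a : ℝ := (n : ℝ) + 1 with ha_def
  have ha : 0 < a := by positivity
  have hd : ∀ y ∈ Set.Icc a (a + 1), HasDerivWithinAt
      (fun y : ℝ ↦ (y : ℂ) ^ (1 - s) + (s - 1) * (a : ℂ) ^ (-s) * y)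
      ((1 - s) * ((y : ℂ) ^ (-s) - (a : ℂ) ^ (-s))) (Set.Icc a (a + 1)) y := fun y hy ↦ by
    have hy0 : 0 < y := ha.trans_le hy.1
    have h := ((hasDerivAt_id (y : ℂ)).cpow_const (c := 1 - s) (Or.inl (by simpa using hy0))).add
      ((hasDerivAt_id (y : ℂ)).const_mul ((s - 1) * (a : ℂ) ^ (-s)))
    refine h.comp_ofReal.hasDerivWithinAt.congr_deriv ?_
    simp only [id, show 1 - s - 1 = -s by ring]
    ring
  have hb : ∀ y ∈ Set.Icc a (a + 1), ‖(1 - s) * ((y : ℂ) ^ (-s) - (a : ℂ) ^ (-s))‖ ≤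
      ‖s - 1‖ * ‖s‖ * a ^ (-s.re - 1) := fun y hy ↦ by
    rw [norm_mul, norm_sub_rev, mul_assoc]
    exact mul_le_mul_of_nonneg_left (norm_ofReal_cpow_neg_sub_le hs ha hy) (norm_nonneg _)
  have h := Convex.norm_image_sub_le_of_norm_hasDerivWithin_le hd hb (convex_Icc _ _)
    (Set.left_mem_Icc.2 (by linarith)) (Set.right_mem_Icc.2 (by linarith))
  rw [add_sub_cancel_left, norm_one, mul_one] at h
  refine le_trans (le_of_eq (congrArg norm ?_)) h
  rw [zetaOneTerm, ha_def]
  push_cast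
  ring

theorem differentiable_zetaOneTerm (n : ℕ) : Differentiable ℂ (zetaOneTerm n) := by
  have h1 : (n : ℂ) + 1 ≠ 0 := by exact_mod_cast n.succ_ne_zero
  have h2 : (n : ℂ) + 1 + 1 ≠ 0 := by exact_mod_cast (n + 1).succ_ne_zero
  unfold zetaOneTerm
  intro s
  refine ((((differentiableAt_id.sub_const _).mul ?_).sub ?_).add ?_)
  · exact differentiableAt_id.neg.const_cpow (Or.inl h1)
  · exact (differentiableAt_id.const_sub _).const_cpow (Or.inl h1)
  · exact (differentiableAt_id.const_sub _).const_cpow (Or.inl h2)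

theorem summable_nat_add_one_rpow {r : ℝ} (hr : r < -1) : Summable fun n : ℕ ↦ ((n : ℝ) + 1) ^ r := by
  simpa using (summable_nat_add_iff 1).2 (Real.summable_nat_rpow.2 hr)

open Complex in
theorem hasSum_zetaOneTerm_of_one_lt_re {s : ℂ} (hs : 1 < s.re) :
    HasSum (fun n ↦ zetaOneTerm n s) (riemannZeta₁ s - 1) := by
  have hs1 : s ≠ 1 := by rintro rfl; simp at hs
  have hz : HasSum (fun n : ℕ ↦ ((n : ℂ) + 1) ^ (-s)) (riemannZeta s) := by
    rw [zeta_eq_tsum_one_div_nat_add_one_cpow hs]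
    simp_rw [cpow_neg, ← one_div]
    refine Summable.hasSum ?_
    simpa using (summable_nat_add_iff 1).2 (Complex.summable_one_div_nat_cpow.2 hs)
  have hsum : Summable fun n ↦ zetaOneTerm n s := by
    refine .of_norm_bounded ((summable_nat_add_one_rpow (r := -s.re - 1) (by linarith)).mul_left _)
      (norm_zetaOneTerm_le (by linarith))
  refine (hsum.hasSum_iff_tendsto_nat).2 ?_
  have hpart : ∀ N : ℕ, ∑ n ∈ Finset.range N, zetaOneTerm n s =
      (s - 1) * ∑ n ∈ Finset.range N, ((n : ℂ) + 1) ^ (-s) + (((N : ℂ) + 1) ^ (1 - s) - 1) := by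
    intro N
    have h := Finset.sum_range_sub (fun n : ℕ ↦ ((n : ℂ) + 1) ^ (1 - s)) N
    simp only [Nat.cast_add, Nat.cast_one, Nat.cast_zero, zero_add, one_cpow] at h
    rw [← h, Finset.mul_sum, ← Finset.sum_add_distrib]
    exact Finset.sum_congr rfl fun n _ ↦ by rw [zetaOneTerm]; ring
  have h0 : Filter.Tendsto (fun N : ℕ ↦ ((N : ℂ) + 1) ^ (1 - s)) .atTop (nhds 0) := by
    rw [tendsto_zero_iff_norm_tendsto_zero]
    have : ∀ N : ℕ, ‖((N : ℂ) + 1) ^ (1 - s)‖ = ((N : ℝ) + 1) ^ (-(s.re - 1)) := fun N ↦ by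
      have := norm_cpow_eq_rpow_re_of_pos (x := (N : ℝ) + 1) (by positivity) (1 - s)
      push_cast at this
      rw [this]; simp
    simp_rw [this]
    exact (tendsto_rpow_neg_atTop (by linarith)).comp
      (Filter.tendsto_atTop_add_const_right _ _ tendsto_natCast_atTop_atTop)
  simp_rw [hpart]
  have := (hz.tendsto_sum_nat.const_mul (s - 1)).add (h0.sub_const 1)
  convert this using 2
  rw [riemannZeta_eq_inv_sub_mul hs1, mul_inv_cancel_left₀ (sub_ne_zero.2 hs1)]
  ring

-- Identity theorem: both sides are holomorphic and agree near `2`. The threshold `1/4` gives the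
-- summable exponent `-5/4` and leaves room around the line `re s = 1/2`.
open Complex in
theorem riemannZeta₁_eq_one_add_tsum {s : ℂ} (hs : 1 / 4 < s.re) :
    riemannZeta₁ s = 1 + ∑' n, zetaOneTerm n s := by
  -- The ball contains both `s` and `2`; its boundedness makes the majorant uniform in `z`.
  set R : ℝ := ‖s‖ + 3 with hR
  set U : Set ℂ := {z | 1 / 4 < z.re} ∩ Metric.ball 0 R with hU
  have hUo : IsOpen U := (isOpen_lt continuous_const continuous_re).inter Metric.isOpen_ball
  have hUc : Convex ℝ U := (convex_halfSpace_re_gt _).inter (convex_ball _ _)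
  have hb : ∀ (n : ℕ) (z : ℂ), z ∈ U →
      ‖zetaOneTerm n z‖ ≤ (R + 1) * R * ((n : ℝ) + 1) ^ (-(5 / 4) : ℝ) := fun n z hz ↦ by
    have hzR : ‖z‖ < R := by simpa using hz.2
    have hz4 : 1 / 4 < z.re := hz.1
    have hz1 : ‖z - 1‖ ≤ R + 1 := (norm_sub_le _ _).trans (by simpa using hzR.le)
    refine (norm_zetaOneTerm_le (by linarith) n).trans ?_
    gcongr
    · linarith
    · linarith
  have hd : DifferentiableOn ℂ (fun z ↦ 1 + ∑' n, zetaOneTerm n z) U :=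
    (differentiableOn_tsum_of_summable_norm
      ((summable_nat_add_one_rpow (r := -(5 / 4)) (by norm_num)).mul_left _)
      (fun n ↦ (differentiable_zetaOneTerm n).differentiableOn) hUo hb).const_add 1
  have h2U : (2 : ℂ) ∈ U := by
    refine ⟨by norm_num, ?_⟩
    simp only [Metric.mem_ball, dist_zero_right, Complex.norm_ofNat, hR]
    linarith [norm_nonneg s]
  have hev : riemannZeta₁ =ᶠ[nhds 2] fun z ↦ 1 + ∑' n, zetaOneTerm n z := by
    filter_upwards [(isOpen_lt continuous_const continuous_re).mem_nhds
      (show (1 : ℝ) < (2 : ℂ).re by norm_num)] with z hz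
    rw [(hasSum_zetaOneTerm_of_one_lt_re hz).tsum_eq]
    ring
  exact (differentiable_riemannZeta₁.differentiableOn.analyticOnNhd hUo).eqOn_of_preconnected_of_eventuallyEq
    (hd.analyticOnNhd hUo) hUc.isPreconnected h2U hev ⟨hs, by simp [hR]⟩

theorem exists_norm_riemannZeta₁_le :
    ∃ K : ℝ, 0 ≤ K ∧ ∀ s : ℂ, 1 / 2 ≤ s.re → ‖riemannZeta₁ s‖ ≤ 1 + K * (‖s - 1‖ * ‖s‖) := by
  have hK := summable_nat_add_one_rpow (r := -(3 / 2)) (by norm_num)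
  refine ⟨∑' n : ℕ, ((n : ℝ) + 1) ^ (-(3 / 2) : ℝ), tsum_nonneg fun n ↦ by positivity, fun s hs ↦ ?_⟩
  rw [riemannZeta₁_eq_one_add_tsum (by linarith), mul_comm, ← tsum_mul_left]
  refine (norm_add_le _ _).trans ?_
  rw [norm_one]
  gcongr
  refine tsum_of_norm_bounded (hK.mul_left _).hasSum fun n ↦
    (norm_zetaOneTerm_le (by linarith) n).trans ?_
  gcongr
  · linarith [(n.cast_nonneg : (0 : ℝ) ≤ n)]
  · linarith

/-! ### Decay of `Γ` in a vertical strip -/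

theorem norm_Gamma_le_Gamma_re {s : ℂ} (hs : 0 < s.re) : ‖Complex.Gamma s‖ ≤ Real.Gamma s.re := by
  rw [Complex.Gamma_eq_integral hs, Real.Gamma_eq_integral hs, Complex.GammaIntegral]
  refine (MeasureTheory.norm_integral_le_integral_norm _).trans (le_of_eq ?_)
  refine MeasureTheory.setIntegral_congr_fun measurableSet_Ioi fun x hx ↦ ?_
  simp [Complex.norm_cpow_eq_rpow_re_of_pos (Set.mem_Ioi.1 hx), Complex.norm_exp]

/-- Four uses of `Γ(s+1) = s Γ(s)`, with `|s| ≤ |s + k|` and `|Γ(s+4)| ≤ Γ(re s + 4) ≤ Γ(6)`. The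
fourth power matches the growth of `((s-1) ζ(s))²`. -/
theorem norm_Gamma_mul_norm_pow_four_le {s : ℂ} (hs : 0 < s.re) (hs2 : s.re ≤ 2) :
    ‖Complex.Gamma s‖ * ‖s‖ ^ 4 ≤ Real.Gamma 6 := by
  have hk : ∀ k : ℕ, ‖s‖ ≤ ‖s + k‖ := fun k ↦ by
    rw [Complex.norm_def, Complex.norm_def]
    refine Real.sqrt_le_sqrt ?_
    simp only [Complex.normSq_apply, Complex.add_re, Complex.add_im, Complex.natCast_re,
      Complex.natCast_im, add_zero]
    have : (0 : ℝ) ≤ k := k.cast_nonneg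
    nlinarith [mul_nonneg hs.le this]
  have hne : ∀ k : ℕ, s + k ≠ 0 := fun k h ↦ by
    have := congrArg Complex.re h
    simp only [Complex.add_re, Complex.natCast_re, Complex.zero_re] at this
    have : (0 : ℝ) ≤ k := k.cast_nonneg
    linarith
  have h : Complex.Gamma (s + 4) = (s + 3) * ((s + 2) * ((s + 1) * (s * Complex.Gamma s))) := by
    have h0 := hne 0
    have h1 := hne 1
    have h2 := hne 2
    have h3 := hne 3
    norm_num at h0 h1 h2 h3
    rw [← Complex.Gamma_add_one _ h0, ← Complex.Gamma_add_one _ h1, add_assoc s 1 1,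
      one_add_one_eq_two, ← Complex.Gamma_add_one _ h2, add_assoc s 2 1, two_add_one_eq_three,
      ← Complex.Gamma_add_one _ h3, add_assoc s 3 1, three_add_one_eq_four]
  have h4 : ‖Complex.Gamma (s + 4)‖ ≤ Real.Gamma 6 := by
    refine (norm_Gamma_le_Gamma_re (by simp; linarith)).trans ?_
    refine Real.Gamma_strictMonoOn_Ici.monotoneOn ?_ ?_ ?_ <;> simp <;> linarith
  refine le_trans ?_ h4
  rw [h]
  simp only [norm_mul]
  have h1 := hk 1
  have h2 := hk 2
  have h3 := hk 3
  push_cast at h1 h2 h3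
  calc ‖Complex.Gamma s‖ * ‖s‖ ^ 4 = ‖s‖ * (‖s‖ * (‖s‖ * (‖s‖ * ‖Complex.Gamma s‖))) := by ring
    _ ≤ _ := by gcongr

/-! ### The product `ζ² Γ`: double pole at `1` and integrability on vertical lines -/

/-- The function `(s - 1) ^ 2 * ζ(s) ^ 2 * Γ(s)`, holomorphic on `0 < re s`. -/
noncomputable def zetaSqGammaNumerator (s : ℂ) : ℂ := riemannZeta₁ s ^ 2 * Complex.Gamma s

theorem zetaSqGamma_eq_div {s : ℂ} (hs : s ≠ 1) :
    riemannZeta s ^ 2 * Complex.Gamma s = zetaSqGammaNumerator s / (s - 1) ^ 2 := by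
  rw [riemannZeta_eq_inv_sub_mul hs, zetaSqGammaNumerator]
  field_simp

theorem exists_norm_zetaSqGammaNumerator_le :
    ∃ M : ℝ, 0 ≤ M ∧ ∀ s : ℂ, 1 / 2 ≤ s.re → s.re ≤ 2 → ‖zetaSqGammaNumerator s‖ ≤ M := by
  obtain ⟨K, hK, hbound⟩ := exists_norm_riemannZeta₁_le
  refine ⟨(4 + 3 * K) ^ 2 * Real.Gamma 6,
    mul_nonneg (sq_nonneg _) (Real.Gamma_nonneg_of_nonneg (by norm_num)), fun s hs hs2 ↦ ?_⟩
  -- This gives `1 ≤ 2‖s‖` and `1 ≤ 4‖s‖²`, the sources of the constants `3` and `4`.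
  have hn : 1 / 2 ≤ ‖s‖ := hs.trans (Complex.re_le_norm s)
  have h1 : ‖s - 1‖ ≤ 3 * ‖s‖ := (norm_sub_le _ _).trans (by rw [norm_one]; linarith)
  have hz : ‖riemannZeta₁ s‖ ≤ (4 + 3 * K) * ‖s‖ ^ 2 := by
    refine (hbound s hs).trans ?_
    have : ‖s - 1‖ * ‖s‖ ≤ 3 * ‖s‖ ^ 2 := by nlinarith
    nlinarith [mul_le_mul_of_nonneg_left this hK]
  rw [zetaSqGammaNumerator, norm_mul, norm_pow]
  calc ‖riemannZeta₁ s‖ ^ 2 * ‖Complex.Gamma s‖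
      ≤ ((4 + 3 * K) * ‖s‖ ^ 2) ^ 2 * ‖Complex.Gamma s‖ := by gcongr
    _ = (4 + 3 * K) ^ 2 * (‖Complex.Gamma s‖ * ‖s‖ ^ 4) := by ring
    _ ≤ _ := by
      gcongr
      exact norm_Gamma_mul_norm_pow_four_le (by linarith) hs2

theorem differentiableAt_Gamma_of_re_pos {s : ℂ} (hs : 0 < s.re) :
    DifferentiableAt ℂ Complex.Gamma s :=
  Complex.differentiableAt_Gamma s fun m h ↦ by
    have : (0 : ℝ) ≤ m := m.cast_nonneg
    rw [h, Complex.neg_re, Complex.natCast_re] at hs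
    linarith

theorem differentiableOn_zetaSqGammaNumerator :
    DifferentiableOn ℂ zetaSqGammaNumerator {s | 0 < s.re} := fun _ hs ↦
  ((differentiable_riemannZeta₁.differentiableAt.pow 2).mul
    (differentiableAt_Gamma_of_re_pos hs)).differentiableWithinAt

theorem zetaSqGammaNumerator_one : zetaSqGammaNumerator 1 = 1 := by
  simp [zetaSqGammaNumerator]

theorem deriv_zetaSqGammaNumerator_one :
    deriv zetaSqGammaNumerator 1 = Real.eulerMascheroniConstant := by
  have hz : HasDerivAt riemannZeta₁ (Real.eulerMascheroniConstant : ℂ) 1 := by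
    rw [← deriv_riemannZeta₁_one]
    exact differentiable_riemannZeta₁.differentiableAt.hasDerivAt
  have h := (hz.pow 2).mul Complex.hasDerivAt_Gamma_one
  have h' : deriv zetaSqGammaNumerator 1 = _ := h.deriv
  rw [h']
  simp
  ring

theorem continuous_zetaSqGammaNumerator_vertical {a : ℝ} (ha : 0 < a) :
    Continuous fun v : ℝ ↦ zetaSqGammaNumerator (a + v * Complex.I) := by
  refine differentiableOn_zetaSqGammaNumerator.continuousOn.comp_continuous (by fun_prop) fun v ↦ ?_
  simpa using ha

theorem integrable_inv_sq_add_sq {a : ℝ} (ha : a ≠ 0) :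
    MeasureTheory.Integrable fun v : ℝ ↦ (a ^ 2 + v ^ 2)⁻¹ := by
  refine ((integrable_inv_one_add_sq.comp_mul_left' (inv_ne_zero ha)).const_mul (a ^ 2)⁻¹).congr
    (.of_forall fun v ↦ ?_)
  simp only
  rw [← mul_inv]
  congr 1
  field_simp

theorem vertical_sub_one_ne_zero {a : ℝ} (ha1 : a ≠ 1) (v : ℝ) :
    (a : ℂ) + v * Complex.I - 1 ≠ 0 := fun h ↦ by
  have := congrArg Complex.re h
  simp only [Complex.sub_re, Complex.add_re, Complex.ofReal_re, Complex.mul_re, Complex.I_re,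
    Complex.ofReal_im, Complex.I_im, Complex.one_re, Complex.zero_re] at this
  exact ha1 (by linarith)

theorem norm_vertical_sq (a v : ℝ) : ‖(a : ℂ) + v * Complex.I‖ ^ 2 = a ^ 2 + v ^ 2 := by
  rw [← Complex.normSq_eq_norm_sq, Complex.normSq_apply]
  simp
  ring

theorem integrable_zetaSqGamma_vertical {a : ℝ} (ha : 1 / 2 ≤ a) (ha2 : a ≤ 2) (ha1 : a ≠ 1) :
    MeasureTheory.Integrable fun v : ℝ ↦ riemannZeta (a + v * Complex.I) ^ 2 *
      Complex.Gamma (a + v * Complex.I) := by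
  obtain ⟨M, hM, hbound⟩ := exists_norm_zetaSqGammaNumerator_le
  have heq : (fun v : ℝ ↦ riemannZeta (a + v * Complex.I) ^ 2 * Complex.Gamma (a + v * Complex.I)) =
      fun v : ℝ ↦ zetaSqGammaNumerator (a + v * Complex.I) / (a + v * Complex.I - 1) ^ 2 :=
    funext fun v ↦ zetaSqGamma_eq_div (sub_ne_zero.1 (vertical_sub_one_ne_zero ha1 v))
  rw [heq]
  refine ((integrable_inv_sq_add_sq (sub_ne_zero.2 ha1)).const_mul M).mono'
    (Continuous.aestronglyMeasurable ?_) (.of_forall fun v ↦ ?_)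
  · exact (continuous_zetaSqGammaNumerator_vertical (by linarith)).div (by fun_prop)
      fun v ↦ pow_ne_zero 2 (vertical_sub_one_ne_zero ha1 v)
  · have h : (a : ℂ) + v * Complex.I - 1 = ((a - 1 : ℝ) : ℂ) + v * Complex.I := by push_cast; ring
    rw [norm_div, norm_pow, h, norm_vertical_sq, div_eq_mul_inv]
    gcongr
    exact hbound _ (by simpa using ha) (by simpa using ha2)

/-! ### Shifting the contour past the pole -/

open Filter Topology

theorem vertical_ne_zero {b : ℝ} (hb : b ≠ 0) (v : ℝ) : (b : ℂ) + v * Complex.I ≠ 0 := fun h ↦ by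
  have := congrArg Complex.re h
  simp at this
  exact hb this

theorem hasDerivAt_vertical (b v : ℝ) :
    HasDerivAt (fun v : ℝ ↦ (b : ℂ) + v * Complex.I) Complex.I v := by
  simpa using ((hasDerivAt_id (v : ℂ)).comp_ofReal.mul_const Complex.I).const_add (b : ℂ)

theorem continuous_inv_vertical {b : ℝ} (hb : b ≠ 0) :
    Continuous fun v : ℝ ↦ ((b : ℂ) + v * Complex.I)⁻¹ :=
  Continuous.inv₀ (by fun_prop) (vertical_ne_zero hb)

theorem continuous_inv_sq_vertical {b : ℝ} (hb : b ≠ 0) :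
    Continuous fun v : ℝ ↦ (((b : ℂ) + v * Complex.I) ^ 2)⁻¹ :=
  Continuous.inv₀ (by fun_prop) fun v ↦ pow_ne_zero 2 (vertical_ne_zero hb v)

/-- A primitive is `arctan(v/b) - (i/2) log(b² + v²)`. The logarithm is even, so it cancels on the
symmetric interval; the integrand is not absolutely integrable on `ℝ`, hence the truncation. -/
theorem integral_inv_vertical {b : ℝ} (hb : b ≠ 0) (T : ℝ) :
    ∫ v in (-T)..T, ((b : ℂ) + v * Complex.I)⁻¹ = ((2 * Real.arctan (T / b) : ℝ) : ℂ) := by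
  have hpos : ∀ v : ℝ, 0 < b ^ 2 + v ^ 2 := fun v ↦ by positivity
  have hd : ∀ v ∈ Set.uIcc (-T) T, HasDerivAt (fun v : ℝ ↦ ((Real.arctan (v / b) : ℝ) : ℂ) -
      ((Real.log (b ^ 2 + v ^ 2) : ℝ) : ℂ) / 2 * Complex.I) (((b : ℂ) + v * Complex.I)⁻¹) v := by
    intro v _
    have h1 := ((hasDerivAt_id v).div_const b).arctan.ofReal_comp
    have h2 := (((hasDerivAt_pow 2 v).const_add (b ^ 2)).log (hpos v).ne').ofReal_comp
    refine (h1.sub ((h2.div_const 2).mul_const Complex.I)).congr_deriv ?_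
    have hb' : (b : ℂ) ≠ 0 := by exact_mod_cast hb
    have h3 : (b : ℂ) ^ 2 + (v : ℂ) ^ 2 ≠ 0 := by exact_mod_cast (hpos v).ne'
    rw [← mul_eq_one_iff_eq_inv₀ (vertical_ne_zero hb v)]
    simp only [id]
    push_cast
    rw [show 1 + ((v : ℂ) / b) ^ 2 = ((b : ℂ) ^ 2 + (v : ℂ) ^ 2) / b ^ 2 by field_simp]
    field_simp
    ring_nf
    simp only [Complex.I_sq]
    ring
  rw [intervalIntegral.integral_eq_sub_of_hasDerivAt hd
    ((continuous_inv_vertical hb).intervalIntegrable _ _)]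
  simp only [neg_div, Real.arctan_neg, neg_sq]
  push_cast
  ring

theorem integral_inv_sq_vertical {b : ℝ} (hb : b ≠ 0) (T : ℝ) :
    ∫ v in (-T)..T, (((b : ℂ) + v * Complex.I) ^ 2)⁻¹ =
      Complex.I * ((b : ℂ) + T * Complex.I)⁻¹ - Complex.I * ((b : ℂ) + (-T : ℝ) * Complex.I)⁻¹ := by
  refine intervalIntegral.integral_eq_sub_of_hasDerivAt (f := fun v : ℝ ↦ Complex.I * ((b : ℂ) + v * Complex.I)⁻¹)
    (fun v _ ↦ ?_) ((continuous_inv_sq_vertical hb).intervalIntegrable _ _)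
  refine (((hasDerivAt_vertical b v).inv (vertical_ne_zero hb v)).const_mul Complex.I).congr_deriv ?_
  rw [neg_div, mul_neg, mul_div_assoc', Complex.I_mul_I, neg_div, neg_neg, one_div]

theorem tendsto_inv_vertical {b : ℝ} {u : ℝ → ℝ} (hu : Tendsto (fun T ↦ |u T|) atTop atTop) :
    Tendsto (fun T : ℝ ↦ ((b : ℂ) + u T * Complex.I)⁻¹) atTop (𝓝 0) := by
  refine tendsto_inv₀_cobounded.comp ?_
  refine tendsto_norm_atTop_iff_cobounded.1 (tendsto_atTop_mono (fun T ↦ ?_) hu)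
  simpa using Complex.abs_im_le_norm ((b : ℂ) + u T * Complex.I)

theorem tendsto_integral_inv_sq_vertical {b : ℝ} (hb : b ≠ 0) :
    Tendsto (fun T : ℝ ↦ ∫ v in (-T)..T, (((b : ℂ) + v * Complex.I) ^ 2)⁻¹) atTop (𝓝 0) := by
  simp_rw [integral_inv_sq_vertical hb]
  have h1 := (tendsto_inv_vertical (b := b) tendsto_abs_atTop_atTop).const_mul Complex.I
  have h2 := (tendsto_inv_vertical (b := b) (u := fun T ↦ -T)
    (by simpa using tendsto_abs_atTop_atTop)).const_mul Complex.I
  simpa using h1.sub h2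

/-- The function `ζ(s) ^ 2 * Γ(s)` with its principal part at `s = 1` removed. -/
noncomputable def zetaSqGammaRegular : ℂ → ℂ := dslope (dslope zetaSqGammaNumerator 1) 1

theorem differentiableOn_zetaSqGammaRegular :
    DifferentiableOn ℂ zetaSqGammaRegular {s | 0 < s.re} := by
  have h : {s : ℂ | 0 < s.re} ∈ 𝓝 (1 : ℂ) :=
    (isOpen_lt continuous_const Complex.continuous_re).mem_nhds (by simp)
  rw [zetaSqGammaRegular, Complex.differentiableOn_dslope h, Complex.differentiableOn_dslope h]
  exact differentiableOn_zetaSqGammaNumerator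

theorem zetaSqGammaRegular_eq {s : ℂ} (hs : s ≠ 1) :
    zetaSqGammaRegular s = zetaSqGammaNumerator s / (s - 1) ^ 2 - ((s - 1) ^ 2)⁻¹ -
      Real.eulerMascheroniConstant * (s - 1)⁻¹ := by
  have hs' := sub_ne_zero.2 hs
  rw [zetaSqGammaRegular, dslope_of_ne _ hs, slope_def_field, dslope_same,
    deriv_zetaSqGammaNumerator_one, dslope_of_ne _ hs, slope_def_field, zetaSqGammaNumerator_one]
  field_simp

/-- The double pole contributes nothing in the limit and the simple pole contributes `γ L`, where
`L` is `π` or `-π` according to the side of `1` on which the line lies. -/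
theorem tendsto_integral_zetaSqGammaRegular_vertical {a L : ℝ} (ha : 1 / 2 ≤ a) (ha2 : a ≤ 2)
    (ha1 : a ≠ 1) (hL : Tendsto (fun T : ℝ ↦ 2 * Real.arctan (T / (a - 1))) atTop (𝓝 L)) :
    Tendsto (fun T : ℝ ↦ ∫ v in (-T)..T, zetaSqGammaRegular (a + v * Complex.I)) atTop
      (𝓝 ((∫ v : ℝ, riemannZeta (a + v * Complex.I) ^ 2 * Complex.Gamma (a + v * Complex.I)) -
        Real.eulerMascheroniConstant * (L : ℂ))) := by
  have hb : a - 1 ≠ 0 := sub_ne_zero.2 ha1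
  have hint := integrable_zetaSqGamma_vertical ha ha2 ha1
  have hcast : ∀ v : ℝ, (a : ℂ) + v * Complex.I - 1 = ((a - 1 : ℝ) : ℂ) + v * Complex.I :=
    fun v ↦ by push_cast; ring
  have heq : ∀ T : ℝ, ∫ v in (-T)..T, zetaSqGammaRegular (a + v * Complex.I) =
      (∫ v in (-T)..T, riemannZeta (a + v * Complex.I) ^ 2 * Complex.Gamma (a + v * Complex.I)) -
      (∫ v in (-T)..T, ((((a - 1 : ℝ) : ℂ) + v * Complex.I) ^ 2)⁻¹) -
      Real.eulerMascheroniConstant * ∫ v in (-T)..T, (((a - 1 : ℝ) : ℂ) + v * Complex.I)⁻¹ := by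
    intro T
    have hF := hint.intervalIntegrable (a := -T) (b := T)
    have h2 := (continuous_inv_sq_vertical hb).intervalIntegrable
      (μ := MeasureTheory.volume) (-T) T
    have h1 := ((continuous_inv_vertical hb).intervalIntegrable
      (μ := MeasureTheory.volume) (-T) T).const_mul (Real.eulerMascheroniConstant : ℂ)
    rw [← intervalIntegral.integral_const_mul, ← intervalIntegral.integral_sub hF h2,
      ← intervalIntegral.integral_sub (hF.sub h2) h1]
    refine intervalIntegral.integral_congr fun v _ ↦ ?_
    have hne := sub_ne_zero.1 (vertical_sub_one_ne_zero ha1 v)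
    rw [zetaSqGammaRegular_eq hne, zetaSqGamma_eq_div hne, hcast]
  simp_rw [heq, integral_inv_vertical hb]
  have h1 := MeasureTheory.intervalIntegral_tendsto_integral hint tendsto_neg_atTop_atBot tendsto_id
  have h3 := ((Complex.continuous_ofReal.tendsto L).comp hL).const_mul
    (Real.eulerMascheroniConstant : ℂ)
  simpa using (h1.sub (tendsto_integral_inv_sq_vertical hb)).sub h3

theorem exists_norm_zetaSqGammaRegular_le :
    ∃ C : ℝ, ∀ s : ℂ, 1 / 2 ≤ s.re → s.re ≤ 2 → 1 ≤ |s.im| → ‖zetaSqGammaRegular s‖ ≤ C / |s.im| := by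
  obtain ⟨M, hM, hbound⟩ := exists_norm_zetaSqGammaNumerator_le
  refine ⟨M + 1 + |Real.eulerMascheroniConstant|, fun s hs hs2 him ↦ ?_⟩
  have hpos : 0 < |s.im| := by linarith
  have hle : |s.im| ≤ ‖s - 1‖ := by simpa using Complex.abs_im_le_norm (s - 1)
  have hle2 : |s.im| ≤ ‖s - 1‖ ^ 2 := by nlinarith
  have hne : s ≠ 1 := by rintro rfl; simp at hpos
  rw [zetaSqGammaRegular_eq hne]
  refine (norm_sub_le _ _).trans ((add_le_add_left (norm_sub_le _ _) _).trans ?_)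
  rw [norm_div, norm_inv, norm_mul, norm_inv, norm_pow, Complex.norm_real, Real.norm_eq_abs,
    add_div, add_div, div_eq_mul_inv |Real.eulerMascheroniConstant|, one_div]
  gcongr
  exact hbound s hs hs2

theorem tendsto_integral_zetaSqGammaRegular_horizontal {u : ℝ → ℝ} (hu : ∀ T, |u T| = |T|) :
    Tendsto (fun T : ℝ ↦ ∫ x in (1 / 2 : ℝ)..2, zetaSqGammaRegular (x + u T * Complex.I)) atTop
      (𝓝 0) := by
  obtain ⟨C, hC⟩ := exists_norm_zetaSqGammaRegular_le
  have h0 : Tendsto (fun T : ℝ ↦ C / T * |2 - 1 / 2|) atTop (𝓝 0) := by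
    simpa using (tendsto_const_nhds.div_atTop tendsto_id).mul_const |(2 - 1 / 2 : ℝ)|
  refine squeeze_zero_norm' ?_ h0
  filter_upwards [eventually_ge_atTop 1] with T hT
  refine intervalIntegral.norm_integral_le_of_norm_le_const fun x hx ↦ ?_
  rw [Set.uIoc_of_le (by norm_num)] at hx
  have hTabs : |T| = T := abs_of_nonneg (by linarith)
  have h := hC (x + u T * Complex.I) (by simpa using hx.1.le) (by simpa using hx.2)
    (by simpa [hu, hTabs] using hT)
  simpa [hu, hTabs] using h

/-- Cauchy's theorem for the regular part on growing rectangles equates the two vertical limits; the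
simple pole then leaves `γ (π - (-π))`. -/
theorem integral_zetaSqGamma_sub_integral_zetaSqGamma :
    (∫ v : ℝ, riemannZeta ((2 : ℝ) + v * Complex.I) ^ 2 * Complex.Gamma ((2 : ℝ) + v * Complex.I)) -
      (∫ v : ℝ, riemannZeta ((1 / 2 : ℝ) + v * Complex.I) ^ 2 *
        Complex.Gamma ((1 / 2 : ℝ) + v * Complex.I)) =
      2 * Real.pi * Real.eulerMascheroniConstant := by
  have hpi : Tendsto (fun T : ℝ ↦ 2 * Real.arctan (T / (2 - 1))) atTop (𝓝 Real.pi) := by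
    have h := (tendsto_nhds_of_tendsto_nhdsWithin Real.tendsto_arctan_atTop).const_mul 2
    rw [mul_div_cancel₀ _ two_ne_zero] at h
    norm_num
    exact h
  have hnpi : Tendsto (fun T : ℝ ↦ 2 * Real.arctan (T / (1 / 2 - 1))) atTop (𝓝 (-Real.pi)) := by
    have h := ((tendsto_nhds_of_tendsto_nhdsWithin Real.tendsto_arctan_atBot).comp
      ((tendsto_id (α := ℝ)).atTop_mul_const_of_neg (show (1 / 2 - 1 : ℝ)⁻¹ < 0 by norm_num))).const_mul 2
    rw [show 2 * (-(Real.pi / 2)) = -Real.pi by ring] at h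
    exact h
  have h2 := tendsto_integral_zetaSqGammaRegular_vertical (a := 2) (by norm_num) le_rfl
    (by norm_num) hpi
  have h1 := tendsto_integral_zetaSqGammaRegular_vertical (a := 1 / 2) le_rfl (by norm_num)
    (by norm_num) hnpi
  have hT := tendsto_integral_zetaSqGammaRegular_horizontal (u := id) fun _ ↦ rfl
  have hB := tendsto_integral_zetaSqGammaRegular_horizontal (u := fun T ↦ -T) abs_neg
  have hrect : ∀ T : ℝ, (∫ x in (1 / 2 : ℝ)..2, zetaSqGammaRegular (x + (-T : ℝ) * Complex.I)) -
      (∫ x in (1 / 2 : ℝ)..2, zetaSqGammaRegular (x + T * Complex.I)) +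
      Complex.I * (∫ v in (-T)..T, zetaSqGammaRegular ((2 : ℝ) + v * Complex.I)) -
      Complex.I * (∫ v in (-T)..T, zetaSqGammaRegular ((1 / 2 : ℝ) + v * Complex.I)) = 0 := by
    intro T
    refine Complex.integral_boundary_rect_eq_zero_of_differentiableOn zetaSqGammaRegular
      ⟨1 / 2, -T⟩ ⟨2, T⟩ (differentiableOn_zetaSqGammaRegular.mono fun s hs ↦ ?_)
    have h := hs.1
    rw [Set.mem_preimage, Set.uIcc_of_le (by norm_num)] at h
    exact lt_of_lt_of_le (by norm_num) h.1
  have hlim := ((hB.sub hT).add (h2.const_mul Complex.I)).sub (h1.const_mul Complex.I)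
  have h0 := tendsto_nhds_unique (hlim.congr hrect) tendsto_const_nhds
  rw [sub_zero, zero_add, ← mul_sub, mul_eq_zero, or_iff_right Complex.I_ne_zero] at h0
  push_cast at h0 ⊢
  linear_combination h0

/-! ### Evaluation on the line `re s = 2` -/

theorem integrable_Gamma_vertical_two :
    MeasureTheory.Integrable fun v : ℝ ↦ Complex.Gamma ((2 : ℝ) + v * Complex.I) := by
  refine ((integrable_inv_sq_add_sq two_ne_zero).const_mul (Real.Gamma 6)).mono'
    (Continuous.aestronglyMeasurable ?_) (.of_forall fun v ↦ ?_)
  · refine ContinuousOn.comp_continuous (s := {s : ℂ | 0 < s.re})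
      (fun s hs ↦ (differentiableAt_Gamma_of_re_pos hs).continuousAt.continuousWithinAt)
      (by fun_prop) fun v ↦ ?_
    simp
  · have h := norm_Gamma_mul_norm_pow_four_le (s := (2 : ℝ) + v * Complex.I) (by simp) (by simp)
    rw [show ‖(2 : ℝ) + (v : ℂ) * Complex.I‖ ^ 4 = (‖(2 : ℝ) + (v : ℂ) * Complex.I‖ ^ 2) ^ 2 by ring,
      norm_vertical_sq] at h
    rw [← div_eq_mul_inv, le_div_iff₀ (by positivity)]
    refine le_trans (mul_le_mul_of_nonneg_left ?_ (norm_nonneg _)) h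
    nlinarith [sq_nonneg v]

/-- Mellin inversion, since `Γ` is the Mellin transform of `e^{-t}`. -/
theorem integral_cpow_neg_mul_Gamma_vertical_two {x : ℝ} (hx : 0 < x) :
    ∫ v : ℝ, (x : ℂ) ^ (-((2 : ℝ) + v * Complex.I)) * Complex.Gamma ((2 : ℝ) + v * Complex.I) =
      2 * Real.pi * Real.exp (-x) := by
  have hmellin : ∀ s : ℂ, 0 < s.re → mellin (fun t : ℝ ↦ (Real.exp (-t) : ℂ)) s = Complex.Gamma s := by
    intro s hs
    rw [Complex.Gamma_eq_integral hs, Complex.GammaIntegral_eq_mellin]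
  have hre : ∀ v : ℝ, 0 < ((2 : ℝ) + v * Complex.I : ℂ).re := fun v ↦ by simp
  have hconv : MellinConvergent (fun t : ℝ ↦ (Real.exp (-t) : ℂ)) (2 : ℝ) := by
    refine (Complex.GammaIntegral_convergent (s := (2 : ℝ)) (by simp)).congr_fun (fun t _ ↦ ?_)
      measurableSet_Ioi
    simp [mul_comm]
  have h := mellinInv_mellin_eq 2 (fun t : ℝ ↦ (Real.exp (-t) : ℂ)) hx hconv ?_
    (Continuous.continuousAt (by fun_prop))
  · rw [mellinInv] at h
    simp_rw [hmellin _ (hre _), smul_eq_mul] at h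
    rw [← h, Complex.real_smul]
    generalize (∫ v : ℝ, (x : ℂ) ^ (-((2 : ℝ) + v * Complex.I)) *
      Complex.Gamma ((2 : ℝ) + v * Complex.I)) = J
    have : (Real.pi : ℂ) ≠ 0 := by exact_mod_cast Real.pi_ne_zero
    push_cast
    field_simp
  · rw [Complex.VerticalIntegrable]
    simp_rw [hmellin _ (hre _)]
    exact integrable_Gamma_vertical_two

/-- Sum and integral may be interchanged because the `(m, n)` term has `L¹` norm `(mn)⁻² ∫ |Γ|`. -/
theorem hasSum_integral_zetaSqGamma_vertical_two :
    HasSum (fun p : ℕ × ℕ ↦ (2 * Real.pi * Real.exp (-(((p.1 : ℝ) + 1) * ((p.2 : ℝ) + 1))) : ℂ))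
      (∫ v : ℝ, riemannZeta ((2 : ℝ) + v * Complex.I) ^ 2 *
        Complex.Gamma ((2 : ℝ) + v * Complex.I)) := by
  set F : ℕ × ℕ → ℝ → ℂ := fun p v ↦
    (((((p.1 : ℝ) + 1) * ((p.2 : ℝ) + 1) : ℝ)) : ℂ) ^ (-((2 : ℝ) + v * Complex.I)) *
      Complex.Gamma ((2 : ℝ) + v * Complex.I) with hF
  have hpos : ∀ p : ℕ × ℕ, 0 < ((p.1 : ℝ) + 1) * ((p.2 : ℝ) + 1) := fun p ↦ by positivity
  have hnorm : ∀ p v, ‖F p v‖ = (((p.1 : ℝ) + 1) ^ (-2 : ℝ) * ((p.2 : ℝ) + 1) ^ (-2 : ℝ)) *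
      ‖Complex.Gamma ((2 : ℝ) + v * Complex.I)‖ := fun p v ↦ by
    rw [hF, norm_mul, Complex.norm_cpow_eq_rpow_re_of_pos (hpos p),
      ← Real.mul_rpow (by positivity) (by positivity)]
    simp
  have hs := summable_nat_add_one_rpow (r := -2) (by norm_num)
  have hint : ∀ p, MeasureTheory.Integrable (F p) := fun p ↦ by
    refine (integrable_Gamma_vertical_two.norm.const_mul
      (((p.1 : ℝ) + 1) ^ (-2 : ℝ) * ((p.2 : ℝ) + 1) ^ (-2 : ℝ))).mono' ?_
      (.of_forall fun v ↦ (hnorm p v).le)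
    refine MeasureTheory.AEStronglyMeasurable.mul (Continuous.aestronglyMeasurable ?_)
      integrable_Gamma_vertical_two.aestronglyMeasurable
    exact Continuous.const_cpow (by fun_prop) (Or.inl (by exact_mod_cast (hpos p).ne'))
  have hsum : Summable fun p ↦ ∫ v, ‖F p v‖ := by
    simp_rw [hnorm, MeasureTheory.integral_const_mul]
    exact (hs.mul_of_nonneg hs (fun _ ↦ by positivity) fun _ ↦ by positivity).mul_right _
  have h := MeasureTheory.hasSum_integral_of_summable_integral_norm hint hsum
  have hterm : ∀ p : ℕ × ℕ, ∫ v, F p v =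
      (2 * Real.pi * Real.exp (-(((p.1 : ℝ) + 1) * ((p.2 : ℝ) + 1))) : ℂ) := fun p ↦ by
    rw [hF, integral_cpow_neg_mul_Gamma_vertical_two (hpos p)]
  simp_rw [hterm] at h
  refine (congrArg (HasSum _) (MeasureTheory.integral_congr_ae (.of_forall fun v ↦ ?_))).mpr h
  have hre : 1 < ((2 : ℝ) + v * Complex.I : ℂ).re := by simp
  set s : ℂ := (2 : ℝ) + v * Complex.I with hsdef
  have hnz : Summable fun n : ℕ ↦ ‖((n : ℂ) + 1) ^ (-s)‖ := by
    refine hs.congr fun n ↦ ?_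
    have := Complex.norm_cpow_eq_rpow_re_of_pos (x := (n : ℝ) + 1) (by positivity) (-s)
    push_cast at this
    rw [this, hsdef]
    simp
  have hz : riemannZeta s = ∑' n : ℕ, ((n : ℂ) + 1) ^ (-s) := by
    rw [zeta_eq_tsum_one_div_nat_add_one_cpow hre]
    simp_rw [Complex.cpow_neg, one_div]
  rw [hz, sq, tsum_mul_tsum_of_summable_norm hnz hnz, ← tsum_mul_right]
  refine tsum_congr fun p ↦ ?_
  rw [hF]
  simp only
  rw [Complex.ofReal_mul, Complex.mul_cpow_ofReal_nonneg (by positivity) (by positivity)]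
  push_cast
  rfl

theorem hasSum_exp_neg_mul_geometric {x : ℝ} (hx : 0 < x) :
    HasSum (fun n : ℕ ↦ Real.exp (-(x * ((n : ℝ) + 1)))) (1 / (Real.exp x - 1)) := by
  have h1 : Real.exp (-x) < 1 := by simpa using hx
  have h := (hasSum_geometric_of_lt_one (Real.exp_pos _).le h1).mul_left (Real.exp (-x))
  have he : 1 < Real.exp x := by simpa using hx
  have hterm : ∀ n : ℕ, Real.exp (-x) * Real.exp (-x) ^ n = Real.exp (-(x * ((n : ℝ) + 1))) :=
    fun n ↦ by
      rw [← Real.exp_nat_mul, ← Real.exp_add]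
      ring_nf
  have hval : Real.exp (-x) * (1 - Real.exp (-x))⁻¹ = 1 / (Real.exp x - 1) := by
    have h2 : Real.exp x - 1 ≠ 0 := by linarith
    have h3 : 1 - Real.exp (-x) ≠ 0 := by linarith
    have h4 : Real.exp (-x) * Real.exp x = 1 := by rw [← Real.exp_add]; simp
    rw [← div_eq_mul_inv, div_eq_div_iff h3 h2]
    linear_combination h4
  simpa only [hterm, hval] using h

theorem hasSum_one_div_exp_sub_one :
    HasSum (fun j : ℕ ↦ 2 * (Real.pi : ℂ) * ((1 / (Real.exp ((j : ℝ) + 1) - 1) : ℝ) : ℂ))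
      (∫ v : ℝ, riemannZeta ((2 : ℝ) + v * Complex.I) ^ 2 *
        Complex.Gamma ((2 : ℝ) + v * Complex.I)) :=
  hasSum_integral_zetaSqGamma_vertical_two.prod_fiberwise fun j ↦
    (Complex.hasSum_ofReal.2 (hasSum_exp_neg_mul_geometric (x := (j : ℝ) + 1)
      (by positivity))).mul_left (2 * (Real.pi : ℂ))

theorem summable_one_div_exp_sub_one :
    Summable fun j : ℕ ↦ 1 / (Real.exp ((j : ℝ) + 1) - 1) := by
  have h : (2 * (Real.pi : ℂ)) ≠ 0 := by simp [Real.pi_ne_zero]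
  exact Complex.summable_ofReal.1 ((summable_mul_left_iff h).1 hasSum_one_div_exp_sub_one.summable)

theorem integral_zetaSqGamma_vertical_half :
    ∫ v : ℝ, riemannZeta ((1 / 2 : ℝ) + v * Complex.I) ^ 2 *
        Complex.Gamma ((1 / 2 : ℝ) + v * Complex.I) =
      2 * Real.pi * (((∑' j : ℕ, 1 / (Real.exp ((j : ℝ) + 1) - 1)) -
        Real.eulerMascheroniConstant : ℝ) : ℂ) := by
  have h1 := hasSum_one_div_exp_sub_one.tsum_eq
  rw [tsum_mul_left, ← Complex.ofReal_tsum] at h1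
  have h2 := integral_zetaSqGamma_sub_integral_zetaSqGamma
  rw [← h1] at h2
  rw [Complex.ofReal_sub]
  linear_combination -h2

/-! ### The functional equation on the critical line -/

-- For `re s = 1/2`, `1 - s` is the conjugate of `s`, so multiplying the functional equation by
-- `ζ(s)` gives `|ζ|² = 2 (2π)⁻ˢ Γ(s) cos(πs/2) ζ(s)²`. Inverting the unimodular part of `(2π)⁻ˢ`
-- conjugates it; inverting the cosine conjugates it and yields `1/cosh(πv)`.
open Complex in
theorem zetaSqGamma_half_eq (v : ℝ) :
    riemannZeta (1 / 2 + I * v) ^ 2 * Complex.Gamma (1 / 2 + I * v) =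
      (Real.sqrt Real.pi : ℂ) * ((‖riemannZeta (1 / 2 + I * v)‖ ^ 2 / Real.cosh (Real.pi * v) : ℝ) : ℂ) *
        ((Real.cos (v * Real.log (2 * Real.pi)) + Real.sin (v * Real.log (2 * Real.pi)) * I) *
          (Real.cosh (Real.pi * v / 2) + Real.sinh (Real.pi * v / 2) * I)) := by
  set s : ℂ := 1 / 2 + I * v with hs
  set y : ℝ := Real.pi * v / 2 with hy
  set L : ℝ := Real.log (2 * Real.pi) with hL
  have hfe := riemannZeta_one_sub (s := s)
    (fun n h ↦ by
      have h := congrArg re h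
      simp [hs] at h
      have : (0 : ℝ) ≤ n := n.cast_nonneg
      linarith)
    (fun h ↦ by
      have h := congrArg re h
      norm_num [hs] at h)
  have hconj : 1 - s = (starRingEnd ℂ) s := by
    apply Complex.ext <;> norm_num [hs]
  rw [hconj, riemannZeta_conj] at hfe
  have hnorm : ((‖riemannZeta s‖ ^ 2 : ℝ) : ℂ) = riemannZeta s * (starRingEnd ℂ) (riemannZeta s) := by
    rw [mul_conj, normSq_eq_norm_sq]
  have hpow : (2 * Real.pi : ℂ) ^ (-s) =
      (Real.sqrt (2 * Real.pi) : ℂ)⁻¹ * (Real.cos (v * L) - Real.sin (v * L) * I) := by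
    have h2 : (2 * Real.pi : ℂ) ≠ 0 := by simp [Real.pi_ne_zero]
    have hlog : Complex.log (2 * Real.pi) = (L : ℂ) := by
      rw [hL, Complex.ofReal_log (by positivity)]
      push_cast
      rfl
    have hsqrt : (Real.sqrt (2 * Real.pi) : ℂ)⁻¹ = Complex.exp (-(L : ℂ) / 2) := by
      rw [Real.sqrt_eq_rpow, Real.rpow_def_of_pos (by positivity), ← hL, ← ofReal_inv,
        ← Real.exp_neg, ofReal_exp]
      push_cast
      ring_nf
    have harg : (Real.cos (v * L) - Real.sin (v * L) * I : ℂ) = Complex.exp (-(v * L : ℝ) * I) := by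
      rw [Complex.exp_mul_I, Complex.cos_neg, Complex.sin_neg, ofReal_cos, ofReal_sin]
      ring
    rw [cpow_def_of_ne_zero h2, hlog, hsqrt, harg, ← Complex.exp_add, hs]
    push_cast
    ring_nf
  have hcos : Complex.cos (Real.pi * s / 2) =
      (Real.sqrt 2 / 2 : ℝ) * (Real.cosh y - Real.sinh y * I) := by
    rw [show (Real.pi : ℂ) * s / 2 = ((Real.pi / 4 : ℝ) : ℂ) + (y : ℂ) * I by
        rw [hs, hy]; push_cast; ring, Complex.cos_add, Complex.cos_mul_I, Complex.sin_mul_I,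
      ← ofReal_cos, ← ofReal_sin, Real.cos_pi_div_four, Real.sin_pi_div_four, ofReal_cosh,
      ofReal_sinh]
    ring
  have hcosh : Real.cosh (Real.pi * v) = Real.cosh y ^ 2 + Real.sinh y ^ 2 := by
    rw [← Real.cosh_two_mul, hy]
    ring_nf
  have hC : ((Real.cosh (Real.pi * v) : ℝ) : ℂ) ≠ 0 := by exact_mod_cast (Real.cosh_pos _).ne'
  have hcosh' : ((Real.cosh (Real.pi * v) : ℝ) : ℂ) = (Real.cosh y : ℂ) ^ 2 + (Real.sinh y : ℂ) ^ 2 := by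
    exact_mod_cast hcosh
  have htrig : (Real.cos (v * L) : ℂ) ^ 2 + (Real.sin (v * L) : ℂ) ^ 2 = 1 := by
    exact_mod_cast Real.cos_sq_add_sin_sq _
  have hsq : (Real.sqrt (2 * Real.pi) : ℂ) = (Real.sqrt 2 : ℂ) * (Real.sqrt Real.pi : ℂ) := by
    rw [Real.sqrt_mul (by norm_num), ofReal_mul]
  have hsq2 : (Real.sqrt 2 : ℂ) ≠ 0 := by exact_mod_cast (Real.sqrt_pos.2 two_pos).ne'
  have hsqp : (Real.sqrt Real.pi : ℂ) ≠ 0 := by exact_mod_cast (Real.sqrt_pos.2 Real.pi_pos).ne'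
  rw [ofReal_div, hnorm, hfe, hpow, hcos, hsq]
  -- What remains is algebra modulo `h1` and `h2`, the two products of a factor with its conjugate.
  generalize riemannZeta s = Z at *
  generalize Complex.Gamma s = G at *
  generalize (Real.cos (v * L) : ℂ) = c at *
  generalize (Real.sin (v * L) : ℂ) = d at *
  generalize (Real.cosh y : ℂ) = p at *
  generalize (Real.sinh y : ℂ) = q at *
  generalize ((Real.cosh (Real.pi * v) : ℝ) : ℂ) = C at *
  have hI := I_sq
  have h1 : (c - d * I) * (c + d * I) = 1 := by linear_combination htrig - d ^ 2 * hI
  have h2 : (p - q * I) * (p + q * I) = C := by linear_combination -hcosh' - q ^ 2 * hI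
  push_cast
  field_simp
  linear_combination (-Z ^ 2 * G * C) * h1 - Z ^ 2 * G * (c - d * I) * (c + d * I) * h2

theorem re_zetaSqGamma_half_eq (v : ℝ) :
    (riemannZeta (1 / 2 + Complex.I * v) ^ 2 * Complex.Gamma (1 / 2 + Complex.I * v)).re =
      Real.sqrt Real.pi * (‖riemannZeta (1 / 2 + Complex.I * (v : ℂ))‖ ^ 2 / Real.cosh (Real.pi * v) *
          (Real.cos (v * Real.log (2 * Real.pi)) * Real.cosh (Real.pi * v / 2) -
            Real.sin (v * Real.log (2 * Real.pi)) * Real.sinh (Real.pi * v / 2))) := by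
  rw [zetaSqGamma_half_eq, ← Complex.ofReal_mul, Complex.re_ofReal_mul, mul_assoc]
  simp only [Complex.mul_re, Complex.mul_im, Complex.add_re, Complex.add_im, Complex.ofReal_re,
    Complex.ofReal_im, Complex.I_re, Complex.I_im]
  ring

theorem norm_riemannZeta_half_neg (v : ℝ) :
    ‖riemannZeta (1 / 2 + Complex.I * ((-v : ℝ) : ℂ))‖ = ‖riemannZeta (1 / 2 + Complex.I * v)‖ := by
  have h : (1 / 2 + Complex.I * ((-v : ℝ) : ℂ)) = (starRingEnd ℂ) (1 / 2 + Complex.I * v) := by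
    apply Complex.ext <;> simp
  rw [h, riemannZeta_conj, Complex.norm_conj]

theorem mainTheorem7 :
    Summable (fun j : ℕ => 1 / (Real.exp ((j : ℝ) + 1) - 1)) ∧
    (MeasureTheory.Integrable
        (fun v : ℝ => riemannZeta (1 / 2 + Complex.I * (v : ℂ)) ^ 2 *
          Complex.Gamma (1 / 2 + Complex.I * (v : ℂ))) MeasureTheory.volume ∧
      (1 / (2 * (Real.pi : ℂ))) *
          ∫ v : ℝ, riemannZeta (1 / 2 + Complex.I * (v : ℂ)) ^ 2 *
            Complex.Gamma (1 / 2 + Complex.I * (v : ℂ)) =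
        (((∑' j : ℕ, 1 / (Real.exp ((j : ℝ) + 1) - 1)) -
          Real.eulerMascheroniConstant : ℝ) : ℂ)) ∧
    (MeasureTheory.IntegrableOn
        (fun v : ℝ => ‖riemannZeta (1 / 2 + Complex.I * (v : ℂ))‖ ^ 2 / Real.cosh (Real.pi * v) *
          (Real.cos (v * Real.log (2 * Real.pi)) * Real.cosh (Real.pi * v / 2) -
            Real.sin (v * Real.log (2 * Real.pi)) * Real.sinh (Real.pi * v / 2)))
        (Set.Ioi 0) MeasureTheory.volume ∧
      ∫ v in Set.Ioi (0 : ℝ),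
          ‖riemannZeta (1 / 2 + Complex.I * (v : ℂ))‖ ^ 2 / Real.cosh (Real.pi * v) *
          (Real.cos (v * Real.log (2 * Real.pi)) * Real.cosh (Real.pi * v / 2) -
            Real.sin (v * Real.log (2 * Real.pi)) * Real.sinh (Real.pi * v / 2)) =
        Real.sqrt Real.pi *
          ((∑' j : ℕ, 1 / (Real.exp ((j : ℝ) + 1) - 1)) - Real.eulerMascheroniConstant)) := by
  have hline : ∀ v : ℝ, ((1 / 2 : ℝ) : ℂ) + v * Complex.I = 1 / 2 + Complex.I * v := fun v ↦ by
    push_cast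
    ring
  have hint := integrable_zetaSqGamma_vertical (a := 1 / 2) le_rfl (by norm_num) (by norm_num)
  have hval := integral_zetaSqGamma_vertical_half
  simp_rw [hline] at hint hval
  have hpi : (Real.pi : ℂ) ≠ 0 := by exact_mod_cast Real.pi_ne_zero
  have hsqrt : Real.sqrt Real.pi ≠ 0 := (Real.sqrt_pos.2 Real.pi_pos).ne'
  refine ⟨summable_one_div_exp_sub_one, ⟨hint, ?_⟩, ?_⟩
  · rw [hval]
    field_simp
  set g : ℝ → ℝ := fun v ↦
    ‖riemannZeta (1 / 2 + Complex.I * (v : ℂ))‖ ^ 2 / Real.cosh (Real.pi * v) *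
      (Real.cos (v * Real.log (2 * Real.pi)) * Real.cosh (Real.pi * v / 2) -
        Real.sin (v * Real.log (2 * Real.pi)) * Real.sinh (Real.pi * v / 2)) with hg
  have hre : ∀ v : ℝ, RCLike.re (riemannZeta (1 / 2 + Complex.I * v) ^ 2 *
      Complex.Gamma (1 / 2 + Complex.I * v)) = Real.sqrt Real.pi * g v := re_zetaSqGamma_half_eq
  have hgint : MeasureTheory.Integrable g := by
    have h := hint.re
    simp_rw [hre] at h
    exact (MeasureTheory.integrable_const_mul_iff (isUnit_iff_ne_zero.2 hsqrt) g).1 h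
  have heven : ∀ v, g (-v) = g v := fun v ↦ by
    simp only [hg, norm_riemannZeta_half_neg]
    simp only [mul_neg, neg_mul, neg_div, Real.cosh_neg, Real.sinh_neg, Real.cos_neg, Real.sin_neg,
      neg_neg]
  have habs : ∀ v, g |v| = g v := fun v ↦ by
    rcases abs_choice v with h | h <;> rw [h]
    exact heven v
  have h2 : ∫ v, g v = 2 * ∫ v in Set.Ioi (0 : ℝ), g v := by
    rw [← integral_comp_abs]
    simp_rw [habs]
  have h3 := integral_re hint
  simp_rw [hre] at h3
  rw [MeasureTheory.integral_const_mul, h2, hval, ← Complex.ofReal_ofNat, ← Complex.ofReal_mul,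
    ← Complex.ofReal_mul, RCLike.re_eq_complex_re, Complex.ofReal_re] at h3
  -- `h3` reads `√π · 2∫g = 2π (∑ - γ)`; writing `π = √π · √π` allows `2√π` to be cancelled.
  refine ⟨hgint.integrableOn, mul_left_cancel₀ (mul_ne_zero two_ne_zero hsqrt) ?_⟩
  have hsq := Real.mul_self_sqrt Real.pi_pos.le
  linear_combination h3 - 2 * ((∑' j : ℕ, 1 / (Real.exp ((j : ℝ) + 1) - 1)) -
    Real.eulerMascheroniConstant) * hsq
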